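/- Graphs are finite and may have multiple edges and loops. The degree $d_G(v)$ is the number of edges incident with $v$, a loop at $v$ being counted twice. For $X\subseteq V(G)$, the edge cut $\delta_G(X)$ is the set of edges with one end in $X$ and the other end in $V(G)\setminus X$. For an odd integer $k$, a graph $G$ is called odd-$k$-edge-connected if it has no edge cut $\delta_G(X)$ whose size is odd and at most $k-2$. Lemma. Let $k\ge 1$ be an odd integer and let $G$ be an odd-$k$-edge-connected graph such that $d_G(v)\in\{k,2k\}$ for every $v\in V(G)$. Let $f(v)=d_G(v)/k$ for each $v\in V(G)$, so that $f(v)\in\{1,2\}$. Then $G$ has an $f$-factor, that is, a spanning subgraph $H$ of $G$ with $d_H(v)=f(v)$ for every $v\in V(G)$. In particular, $H$ is a $\{1,2\}$-factor of $G$. -/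

import Mathlib

namespace Graph

/-- The degree of a vertex of a multigraph: the number of edges incident with it, where a loop is
counted twice (once for each of its two half-edges). -/
noncomputable def degree {α β : Type*} (G : Graph α β) (v : α) : ℕ :=
  (G.incidenceSet v).ncard + (G.loopSet v).ncard

/-- The edge cut of `G` given by the vertex set `X`: all edges with one end in `X` and the other
end outside `X`. -/
def edgeCut {α β : Type*} (G : Graph α β) (X : Set α) : Set β :=
  {e | ∃ x ∈ X, ∃ y ∉ X, G.IsLink e x y}

/-- `F` is an odd edge cut with `j` edges. -/
def IsOddEdgeCut {α β : Type*} (G : Graph α β) (j : ℕ) (F : Set β) : Prop :=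
  (∃ X ⊆ G.vertexSet, F = G.edgeCut X) ∧ F.ncard = j ∧ Odd j

/-- `G` is odd-`k`-edge-connected: no odd edge cut has `k - 2` or fewer edges. -/
def OddEdgeConnected {α β : Type*} (G : Graph α β) (k : ℕ) : Prop :=
  ∀ (j : ℕ) (F : Set β), j + 2 ≤ k → ¬ G.IsOddEdgeCut j F

/-- `H` is an `f`-factor of `G`: a (necessarily spanning, when `f` is positive) subgraph in which
every vertex `v` of `G` has degree `f v`. -/
def IsFactor {α β : Type*} (G : Graph α β) (f : α → ℕ) (H : Graph α β) : Prop :=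
  H.IsSpanningSubgraph G ∧ ∀ v ∈ G.vertexSet, H.degree v = f v

/-- The vertex sets of the connected components of `G`. -/
def componentSets {α β : Type*} (G : Graph α β) : Set (Set α) :=
  {C | ∃ v ∈ G.vertexSet, C = {w | Relation.ReflTransGen G.Adj v w}}

/-- Deleting an odd edge cut of a finite graph increases the number of components. Hence a graph
with no edge set `F` of odd size at most `k - 2` such that `G - F` has more components than `G`
is in particular odd-`k`-edge-connected. -/
theorem IsOddEdgeCut.ncard_componentSets_lt {α β : Type*} {G : Graph α β}
    (hV : G.vertexSet.Finite) {j : ℕ} {F : Set β} (hF : G.IsOddEdgeCut j F) :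
    G.componentSets.ncard < (G.deleteEdges F).componentSets.ncard := by
  obtain ⟨⟨X, -, rfl⟩, hj, hodd⟩ := hF
  set K := G.deleteEdges (G.edgeCut X) with hK
  have hKV : K.vertexSet = G.vertexSet := by simp [hK]
  have hle : ∀ {a b}, Relation.ReflTransGen K.Adj a b → Relation.ReflTransGen G.Adj a b :=
    fun h => Relation.ReflTransGen.mono (fun _ _ h => Adj.mono deleteEdges_le h) _ _ h
  have hX : ∀ {a b}, Relation.ReflTransGen K.Adj a b → a ∈ X → b ∈ X := by
    intro a b h ha
    induction h with
    | refl => exact ha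
    | tail _ hbc ih =>
      by_contra hc
      obtain ⟨e, he⟩ := hbc
      simp only [hK, deleteEdges_isLink] at he
      exact he.2 ⟨_, ih, _, hc, he.1⟩
  have hsymm : ∀ {a b}, Relation.ReflTransGen G.Adj a b → Relation.ReflTransGen G.Adj b a :=
    fun h => Std.Symm.symm _ _ h
  let g : Set α → Set α := fun C => {w | ∃ v ∈ C, Relation.ReflTransGen G.Adj v w}
  have hg : ∀ v, g {w | Relation.ReflTransGen K.Adj v w} = {w | Relation.ReflTransGen G.Adj v w} := by
    intro v
    ext w
    constructor
    · rintro ⟨u, hu, huw⟩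
      exact (hle hu).trans huw
    · intro h
      exact ⟨v, Relation.ReflTransGen.refl, h⟩
  have himg : G.componentSets = g '' K.componentSets := by
    ext C
    constructor
    · rintro ⟨v, hv, rfl⟩
      exact ⟨_, ⟨v, hKV ▸ hv, rfl⟩, hg v⟩
    · rintro ⟨_, ⟨v, hv, rfl⟩, rfl⟩
      exact ⟨v, hKV ▸ hv, hg v⟩
  have hfin : K.componentSets.Finite := by
    refine (hV.image fun v => {w | Relation.ReflTransGen K.Adj v w}).subset ?_
    rintro _ ⟨v, hv, rfl⟩
    exact ⟨v, hKV ▸ hv, rfl⟩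
  have hne : (G.edgeCut X).Nonempty := by
    rw [Set.nonempty_iff_ne_empty]
    intro h
    rw [h, Set.ncard_empty] at hj
    subst hj
    exact absurd hodd (by decide)
  obtain ⟨e, x, hx, y, hy, he⟩ := hne
  have hxy : Relation.ReflTransGen G.Adj x y := Relation.ReflTransGen.single ⟨e, he⟩
  rw [himg]
  refine lt_of_le_of_ne (Set.ncard_image_le hfin) fun h => ?_
  have hinj := (Set.ncard_image_iff hfin).1 h
  have h1 := hinj ⟨x, hKV ▸ he.left_mem, rfl⟩ ⟨y, hKV ▸ he.right_mem, rfl⟩ (by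
    rw [hg, hg]
    ext w
    exact ⟨fun h => (hsymm hxy).trans h, fun h => hxy.trans h⟩)
  have h2 : y ∈ {w | Relation.ReflTransGen K.Adj x w} := by
    rw [h1]
    exact Relation.ReflTransGen.refl
  exact hy (hX h2 hx)

end Graph

/-! Giving every edge weight 1/k yields a fractional `f`-factor, since every degree is `k * f v`. To
make it integral, pass to perfect matchings of a gadget graph: `f v` copies of each vertex, two
adjacent nodes for the half-edges of each edge, each half-edge also joined to the copies of its end.
Given a perfect matching, the edges whose half-edges are not matched to each other form an
`f`-factor; a loop counts twice.

The fractional factor, scaled by `2 * k`, weights the gadget so that every node has weighted degree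
`2 * k`. By Tutte's theorem it is enough that every odd node set has boundary weight at least `2 *
k` (`le_sum_edgeCost`). A set separating two copies of a vertex meets this bound directly; otherwise
a parity count reduces it to odd cuts of `G`, which have at least `k` edges. -/

/-! ### Perfect matchings from edge weights -/

/-- A nonnegative integral weighting of the edges of a simple graph with all weighted degrees at
most `r`, such that every odd vertex set has weight at least `r` on its boundary, forces a perfect
matching. -/
theorem SimpleGraph.exists_isPerfectMatching_of_weight {W : Type*} [Fintype W] [DecidableEq W]
    (G : SimpleGraph W) (w : W → W → ℕ) {r : ℕ} (hr : 0 < r)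
    (hadj : ∀ x y, w x y ≠ 0 → G.Adj x y) (hsum : ∀ y, ∑ x, w x y ≤ r)
    (hcut : ∀ C : Finset W, Odd C.card → r ≤ ∑ x ∈ C, ∑ y ∈ Cᶜ, w x y) :
    ∃ M : G.Subgraph, M.IsPerfectMatching := by
  classical
  rw [SimpleGraph.tutte]
  intro S hS
  rw [IsTutteViolator] at hS
  set K := ((⊤ : G.Subgraph).deleteVerts S) with hK
  set O := K.coe.oddComponents with hO
  let comp : K.coe.ConnectedComponent → Finset W := fun c => (c.supp.toFinset).image Subtype.val
  have hmem : ∀ c x, x ∈ comp c ↔ ∃ h : x ∈ K.verts, (⟨x, h⟩ : K.verts) ∈ c.supp := by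
    intro c x
    simp [comp]
  have hdisj : Set.PairwiseDisjoint (↑O.toFinset : Set K.coe.ConnectedComponent) comp := by
    intro c _ c' _ hcc
    refine Finset.disjoint_left.2 fun x hx hx' => hcc ?_
    obtain ⟨h, hx⟩ := (hmem _ _).1 hx
    obtain ⟨h', hx'⟩ := (hmem _ _).1 hx'
    exact ConnectedComponent.eq_of_common_vertex hx hx'
  have hbound : ∀ c ∈ O.toFinset, r ≤ ∑ x ∈ comp c, ∑ y ∈ S.toFinset, w x y := by
    intro c hc
    have hodd : Odd (comp c).card := by
      have h := Set.mem_toFinset.1 hc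
      rw [hO, SimpleGraph.oddComponents, Set.mem_ofPred_eq] at h
      rwa [Finset.card_image_of_injective _ Subtype.val_injective, ← Set.ncard_eq_toFinset_card']
    refine (hcut _ hodd).trans (Finset.sum_le_sum fun x hx => ?_)
    -- Nonzero weight means adjacency, and an edge leaving a component of `G - S` ends in `S`. So
    -- each odd component sends weight at least `r` into `S`, which receives at most `r` per vertex.
    refine Finset.sum_le_sum_of_ne_zero fun y hy hw => ?_
    by_contra hyS
    obtain ⟨h, hx⟩ := (hmem _ _).1 hx
    have hyK : y ∈ K.verts := by simpa [hK] using hyS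
    have hxS : x ∉ S := by simpa [hK] using h
    have hyS' : y ∉ S := by simpa using hyS
    have hKadj : K.coe.Adj ⟨x, h⟩ ⟨y, hyK⟩ := by
      simp [hK, hxS, hyS', hadj _ _ hw]
    exact (Finset.mem_compl.1 hy) ((hmem _ _).2 ⟨hyK, (c.mem_supp_congr_adj hKadj).1 hx⟩)
  have h1 : O.toFinset.card * r ≤ ∑ c ∈ O.toFinset, ∑ x ∈ comp c, ∑ y ∈ S.toFinset, w x y := by
    simpa using Finset.sum_le_sum hbound
  rw [← Finset.sum_biUnion hdisj] at h1
  have h2 : ∑ x ∈ O.toFinset.biUnion comp, ∑ y ∈ S.toFinset, w x y ≤ S.toFinset.card * r := by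
    refine (Finset.sum_le_univ_sum_of_nonneg fun _ => Nat.zero_le _).trans ?_
    rw [Finset.sum_comm]
    simpa using Finset.sum_le_sum fun y (_ : y ∈ S.toFinset) => hsum y
  rw [Set.ncard_eq_toFinset_card' S, Set.ncard_eq_toFinset_card' O] at hS
  exact absurd (h1.trans h2) (not_le.2 (Nat.mul_lt_mul_of_pos_right hS hr))

/-! ### The gadget graph and its boundary weights -/

section HalfEdges

variable {V E : Type*} [DecidableEq V] [DecidableEq E]

/-- The weights of the gadget graph: every vertex `v` is replaced by `f v` copies, and every edge
by its two half-edges, which are joined to each other and to the copies of their end. -/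
def halfEdgeWeight (a : E × Bool → V) (f : V → ℕ) (k : ℕ) :
    (Σ v, Fin (f v)) ⊕ (E × Bool) → (Σ v, Fin (f v)) ⊕ (E × Bool) → ℕ
  | .inl _, .inl _ => 0
  | .inl x, .inr d => if a d = x.1 then 2 / f x.1 else 0
  | .inr d, .inl x => if a d = x.1 then 2 / f x.1 else 0
  | .inr d, .inr d' => if d' = (d.1, !d.2) then 2 * (k - 1) else 0

theorem halfEdgeWeight_symm (a : E × Bool → V) (f : V → ℕ) (k : ℕ) (x y) :
    halfEdgeWeight a f k x y = halfEdgeWeight a f k y x := by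
  rcases x with x | ⟨e, b⟩ <;> rcases y with y | ⟨e', b'⟩ <;> simp only [halfEdgeWeight]
  congr 1
  simp only [Prod.mk.injEq, eq_iff_iff]
  constructor <;> rintro ⟨rfl, rfl⟩ <;> simp

/-- The gadget graph whose perfect matchings correspond to `f`-factors. -/
def halfEdgeGraph (a : E × Bool → V) (f : V → ℕ) (k : ℕ) :
    SimpleGraph ((Σ v, Fin (f v)) ⊕ (E × Bool)) where
  Adj x y := halfEdgeWeight a f k x y ≠ 0
  symm := ⟨fun x y h => by rwa [halfEdgeWeight_symm]⟩
  loopless := ⟨fun x => by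
    rcases x with x | ⟨e, b⟩ <;> simp [halfEdgeWeight]⟩

variable [Fintype V] [Fintype E]

/-- A copy of `v` sees `k * f v` half-edges of weight `2 / f v`; a half-edge sees total weight 2 on
the copies of its end and `2 * (k - 1)` on its partner. The scale `2 * k` rather than `k` keeps `2 /
f v` integral. -/
theorem sum_halfEdgeWeight {a : E × Bool → V} {f : V → ℕ} {k : ℕ} (hk : 0 < k)
    (hf : ∀ v, f v = 1 ∨ f v = 2)
    (hdeg : ∀ v, (Finset.univ.filter fun d => a d = v).card = k * f v) (y) :
    ∑ x, halfEdgeWeight a f k x y = 2 * k := by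
  have h2 : ∀ v, f v * (2 / f v) = 2 := fun v => by rcases hf v with h | h <;> simp [h]
  rw [Fintype.sum_sum_type]
  rcases y with ⟨v, i⟩ | ⟨e, b⟩
  · simp only [halfEdgeWeight, Finset.sum_const_zero, zero_add, Finset.sum_ite,
      Finset.sum_const, add_zero, smul_eq_mul]
    rw [hdeg, mul_assoc, h2, mul_comm]
  · rw [Fintype.sum_sigma]
    have h3 : ∀ d : E × Bool, ((e, b) = (d.1, !d.2)) ↔ d = (e, !b) := by
      rintro ⟨e', b'⟩
      simp only [Prod.mk.injEq]
      constructor <;> rintro ⟨rfl, rfl⟩ <;> simp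
    simp only [halfEdgeWeight, h3, Finset.sum_const, Finset.card_univ, Fintype.card_fin,
      smul_eq_mul, mul_ite, mul_zero, Finset.sum_ite_eq, Finset.sum_ite_eq', Finset.mem_univ,
      if_true, h2]
    omega

/-- The boundary weight that a vertex set `C` of the gadget graph has on the edges between a
half-edge and the copies of its end. -/
def endCost (a : E × Bool → V) (f : V → ℕ) (C : Finset ((Σ v, Fin (f v)) ⊕ (E × Bool)))
    (d : E × Bool) : ℕ :=
  ∑ i : Fin (f (a d)), if (.inl ⟨a d, i⟩ ∈ C ↔ .inr d ∈ C) then 0 else 2 / f (a d)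

/-- The boundary weight that a vertex set `C` of the gadget graph has on the gadget of an edge. -/
def edgeCost (a : E × Bool → V) (f : V → ℕ) (k : ℕ) (C : Finset ((Σ v, Fin (f v)) ⊕ (E × Bool)))
    (e : E) : ℕ :=
  endCost a f C (e, true) + endCost a f C (e, false) +
    if (.inr (e, true) ∈ C ↔ .inr (e, false) ∈ C) then 0 else 2 * (k - 1)

theorem sum_edgeCost (a : E × Bool → V) (f : V → ℕ) (k : ℕ)
    (C : Finset ((Σ v, Fin (f v)) ⊕ (E × Bool))) :
    ∑ x ∈ C, ∑ y ∈ Cᶜ, halfEdgeWeight a f k x y = ∑ e, edgeCost a f k C e := by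
  have h0 : ∑ x ∈ C, ∑ y ∈ Cᶜ, halfEdgeWeight a f k x y =
      ∑ x, ∑ y, if x ∈ C ∧ y ∉ C then halfEdgeWeight a f k x y else 0 := by
    simp only [ite_and, Finset.sum_ite_irrel, Finset.sum_const_zero, ← Finset.sum_filter]
    simp [Finset.compl_eq_univ_sdiff, Finset.sdiff_eq_filter]
  have h1 : ∀ d : E × Bool, endCost a f C d =
      (∑ x : Σ v, Fin (f v), if .inl x ∈ C ∧ .inr d ∉ C then
        halfEdgeWeight a f k (.inl x) (.inr d) else 0) +
      ∑ x : Σ v, Fin (f v), if .inr d ∈ C ∧ .inl x ∉ C then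
        halfEdgeWeight a f k (.inr d) (.inl x) else 0 := by
    intro d
    rw [← Finset.sum_add_distrib, Fintype.sum_sigma, Finset.sum_eq_single (a d)]
    · refine Finset.sum_congr rfl fun i _ => ?_
      by_cases hi : (.inl ⟨a d, i⟩ : (Σ v, Fin (f v)) ⊕ (E × Bool)) ∈ C <;>
        by_cases hd : (.inr d : (Σ v, Fin (f v)) ⊕ (E × Bool)) ∈ C <;>
        simp [hi, hd, halfEdgeWeight]
    · intro v _ hv
      refine Finset.sum_eq_zero fun i _ => ?_
      simp [halfEdgeWeight, hv.symm]
    · simp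
  have h2 : ∀ d : E × Bool, (∑ d' : E × Bool, if .inr d ∈ C ∧ .inr d' ∉ C then
        halfEdgeWeight a f k (.inr d) (.inr d') else 0) =
      if .inr d ∈ C ∧ .inr (d.1, !d.2) ∉ C then 2 * (k - 1) else 0 := by
    intro d
    rw [Finset.sum_eq_single (d.1, !d.2)]
    · simp [halfEdgeWeight]
    · intro d' _ hd'
      simp [halfEdgeWeight, hd']
    · simp
  rw [h0, Fintype.sum_sum_type]
  simp only [Fintype.sum_sum_type (α₁ := Σ v, Fin (f v))]
  rw [Finset.sum_add_distrib, Finset.sum_add_distrib]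
  rw [Finset.sum_comm (γ := Σ v, Fin (f v)) (α := E × Bool)]
  simp only [h2]
  have h3 : (∑ x : Σ v, Fin (f v), ∑ y : Σ v, Fin (f v),
      if Sum.inl x ∈ C ∧ Sum.inl y ∉ C then
        halfEdgeWeight a f k (.inl x) (.inl y) else 0) = 0 := by
    simp [halfEdgeWeight]
  rw [h3, zero_add, ← add_assoc, ← Finset.sum_add_distrib]
  simp only [← h1]
  rw [← Finset.sum_add_distrib, Fintype.sum_prod_type]
  refine Finset.sum_congr rfl fun e _ => ?_
  rw [Fintype.sum_bool, edgeCost]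
  by_cases hp : (.inr (e, true) : (Σ v, Fin (f v)) ⊕ (E × Bool)) ∈ C <;>
    by_cases hq : (.inr (e, false) : (Σ v, Fin (f v)) ⊕ (E × Bool)) ∈ C <;>
    simp [hp, hq] <;> ring

end HalfEdges

/-! ### Odd cuts of the gadget graph, and the factor -/

section HalfEdges

variable {V E : Type*} [DecidableEq V] [DecidableEq E]
variable [Fintype E]

/-- Here `f v = 2`, and each of the `2 * k` half-edges at `v` is separated from one of the two
copies, at weight 1. -/
theorem le_sum_edgeCost_of_split {a : E × Bool → V} {f : V → ℕ} {k : ℕ}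
    (hf : ∀ v, f v = 1 ∨ f v = 2)
    (hdeg : ∀ v, (Finset.univ.filter fun d => a d = v).card = k * f v)
    (C : Finset ((Σ v, Fin (f v)) ⊕ (E × Bool))) {v : V} {i j : Fin (f v)}
    (hi : .inl ⟨v, i⟩ ∈ C) (hj : .inl ⟨v, j⟩ ∉ C) :
    2 * k ≤ ∑ e, edgeCost a f k C e := by
  have hij : i ≠ j := by rintro rfl; exact hj hi
  have hfv : f v = 2 := by
    rcases hf v with h | h
    · exact absurd (Fin.ext (by omega)) hij
    · exact h
  have h1 : ∀ d : E × Bool, (if a d = v then 1 else 0) ≤ endCost a f C d := by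
    intro d
    split_ifs with hd
    · subst hd
      have key : ∀ l : Fin (f (a d)),
          ¬ ((.inl ⟨a d, l⟩ : (Σ v, Fin (f v)) ⊕ (E × Bool)) ∈ C ↔ .inr d ∈ C) →
          1 ≤ endCost a f C d := by
        intro l hl
        refine le_trans ?_ (Finset.single_le_sum (fun _ _ => Nat.zero_le _) (Finset.mem_univ l))
        simp [hl, hfv]
      by_cases hd : (.inr d : (Σ v, Fin (f v)) ⊕ (E × Bool)) ∈ C
      · exact key j (by simp [hj, hd])
      · exact key i (by simp [hi, hd])
    · exact Nat.zero_le _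
  calc 2 * k = ∑ d : E × Bool, if a d = v then 1 else 0 := by
        rw [Finset.sum_boole, hdeg, hfv, mul_comm, Nat.cast_id]
    _ ≤ ∑ d : E × Bool, endCost a f C d := Finset.sum_le_sum fun d _ => h1 d
    _ = ∑ e, (endCost a f C (e, true) + endCost a f C (e, false)) := by
        rw [Fintype.sum_prod_type]
        simp
    _ ≤ _ := Finset.sum_le_sum fun e _ => Nat.le_add_right _ _

variable [Fintype V]

/-- If no copies are split, `C` consists of all copies of a vertex set `X` and some half-edges. With
`m` the number of edges crossing `X` and `n` the number of those whose half-edges are separated by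
`C`, oddness of `k` gives `|C| ≡ m + n` mod 2. -/
theorem le_sum_edgeCost {a : E × Bool → V} {f : V → ℕ} {k : ℕ} (hk : Odd k) (hk2 : 2 ≤ k)
    (hf : ∀ v, f v = 1 ∨ f v = 2)
    (hdeg : ∀ v, (Finset.univ.filter fun d => a d = v).card = k * f v)
    (hodd : ∀ X : Finset V,
      Odd (Finset.univ.filter fun e => ¬ (a (e, true) ∈ X ↔ a (e, false) ∈ X)).card →
      k ≤ (Finset.univ.filter fun e => ¬ (a (e, true) ∈ X ↔ a (e, false) ∈ X)).card)
    (C : Finset ((Σ v, Fin (f v)) ⊕ (E × Bool))) (hC : Odd C.card) :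
    2 * k ≤ ∑ e, edgeCost a f k C e := by
  by_cases hsplit : ∃ v, ∃ i j : Fin (f v), .inl ⟨v, i⟩ ∈ C ∧ .inl ⟨v, j⟩ ∉ C
  · obtain ⟨v, i, j, hi, hj⟩ := hsplit
    exact le_sum_edgeCost_of_split hf hdeg C hi hj
  push Not at hsplit
  set X : Finset V := Finset.univ.filter fun v => ∃ i : Fin (f v), .inl ⟨v, i⟩ ∈ C with hX
  have hCX : ∀ v (i : Fin (f v)), .inl ⟨v, i⟩ ∈ C ↔ v ∈ X := by
    intro v i
    simp only [hX, Finset.mem_filter, Finset.mem_univ, true_and]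
    exact ⟨fun h => ⟨i, h⟩, fun ⟨j, h⟩ => hsplit v j i h⟩
  have hend : ∀ d, endCost a f C d = if (a d ∈ X ↔ .inr d ∈ C) then 0 else 2 := by
    intro d
    have : f (a d) * (2 / f (a d)) = 2 := by rcases hf (a d) with h | h <;> simp [h]
    simp [endCost, hCX, this]
  by_contra! hlt
  have hlt' : ∀ e, edgeCost a f k C e < 2 * k := fun e =>
    (Finset.single_le_sum (fun _ _ => Nat.zero_le _) (Finset.mem_univ e)).trans_lt hlt
  let A : E → Bool → ℕ := fun e b => if a (e, b) ∈ X then 1 else 0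
  let P : E → Bool → ℕ := fun e b => if .inr (e, b) ∈ C then 1 else 0
  let m : E → ℕ := fun e => if ¬ (a (e, true) ∈ X ↔ a (e, false) ∈ X) then 1 else 0
  let n : E → ℕ := fun e => if ¬ (a (e, true) ∈ X ↔ a (e, false) ∈ X) ∧
    ¬ (.inr (e, true) ∈ C ↔ .inr (e, false) ∈ C) then 1 else 0
  -- Separated half-edges whose ends lie on the same side of `X` would cost `2 + 2 * (k - 1) = 2 *
  -- k`, excluded by `hlt'`; so `n` detects every separated pair. A crossing edge costs 2 if its
  -- pair is together and at least `2 * (k - 1)` otherwise.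
  have hlocal : ∀ e, Even (P e true + P e false + n e) ∧ Even (A e true + A e false + m e) ∧
      n e ≤ m e ∧ 2 * m e + (2 * k - 4) * n e ≤ edgeCost a f k C e := by
    intro e
    have h := hlt' e
    rw [edgeCost, hend, hend] at h ⊢
    simp only [A, P, m, n]
    by_cases h1 : a (e, true) ∈ X <;> by_cases h2 : a (e, false) ∈ X <;>
      by_cases h3 : (.inr (e, true) : (Σ v, Fin (f v)) ⊕ (E × Bool)) ∈ C <;>
      by_cases h4 : (.inr (e, false) : (Σ v, Fin (f v)) ⊕ (E × Bool)) ∈ C <;>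
      simp [h1, h2, h3, h4] at h ⊢ <;> omega
  have hcardC : C.card = ∑ v ∈ X, f v + ∑ e, (P e true + P e false) := by
    rw [← Finset.filter_univ_mem C, Finset.card_filter, Fintype.sum_sum_type, Fintype.sum_sigma,
      Fintype.sum_prod_type]
    simp only [hCX, P, Fintype.sum_bool]
    simp
  have hdegX : ∑ e, (A e true + A e false) = k * ∑ v ∈ X, f v := by
    have h1 : ∑ e, (A e true + A e false) = ∑ d : E × Bool, if a d ∈ X then 1 else 0 := by
      rw [Fintype.sum_prod_type]
      simp only [A, Fintype.sum_bool]
    rw [h1, Finset.sum_boole, Nat.cast_id,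
      Finset.card_eq_sum_card_fiberwise (f := a) (t := X) (by intro d; simp), Finset.mul_sum]
    refine Finset.sum_congr rfl fun v hv => ?_
    rw [← hdeg, Finset.filter_filter]
    congr 1
    ext d
    simp only [Finset.mem_filter, Finset.mem_univ, true_and]
    exact ⟨fun h => h.2, fun h => ⟨h ▸ hv, h⟩⟩
  have hPn : Even (∑ e, (P e true + P e false) + ∑ e, n e) := by
    rw [← Finset.sum_add_distrib]
    exact Finset.even_sum _ fun e _ => (hlocal e).1
  have hAm : Even (∑ e, (A e true + A e false) + ∑ e, m e) := by
    rw [← Finset.sum_add_distrib]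
    exact Finset.even_sum _ fun e _ => (hlocal e).2.1
  have hnm : ∑ e, n e ≤ ∑ e, m e := Finset.sum_le_sum fun e _ => (hlocal e).2.2.1
  have hcost : 2 * ∑ e, m e + (2 * k - 4) * ∑ e, n e ≤ ∑ e, edgeCost a f k C e := by
    rw [Finset.mul_sum, Finset.mul_sum, ← Finset.sum_add_distrib]
    exact Finset.sum_le_sum fun e _ => (hlocal e).2.2.2
  have hm := hodd X
  rw [Finset.card_filter] at hm
  change Odd (∑ e, m e) → k ≤ ∑ e, m e at hm
  have hpar : Odd (∑ e, m e + ∑ e, n e) := by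
    rw [hcardC] at hC
    rw [hdegX] at hAm
    simp only [← Nat.not_even_iff_odd, Nat.even_add, Nat.even_mul] at *
    tauto
  -- If `n = 0`, then `m` is odd, so `m ≥ k` and the cost is at least `2 * k`. Otherwise `m ≥ n ≥ 1`
  -- with `m + n` odd forces `m ≥ 2`, and the cost is at least `4 + (2 * k - 4)`.
  rcases Nat.eq_zero_or_pos (∑ e, n e) with h0 | hpos
  · rw [h0, add_zero] at hpar
    have := hm hpar
    omega
  · have h2 : 2 ≤ ∑ e, m e := by
      rcases hpar with ⟨t, ht⟩
      omega
    have : (2 * k - 4) * 1 ≤ (2 * k - 4) * ∑ e, n e := Nat.mul_le_mul_left _ hpos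
    omega

/-- The `f`-factor theorem for odd-`k`-edge-connected multigraphs with degrees `k * f v`,
with a multigraph given by the ends `a` of its half-edges. -/
theorem exists_halfEdge_factor {a : E × Bool → V} {f : V → ℕ} {k : ℕ} (hk : Odd k) (hk2 : 2 ≤ k)
    (hf : ∀ v, f v = 1 ∨ f v = 2)
    (hdeg : ∀ v, (Finset.univ.filter fun d => a d = v).card = k * f v)
    (hodd : ∀ X : Finset V,
      Odd (Finset.univ.filter fun e => ¬ (a (e, true) ∈ X ↔ a (e, false) ∈ X)).card →
      k ≤ (Finset.univ.filter fun e => ¬ (a (e, true) ∈ X ↔ a (e, false) ∈ X)).card) :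
    ∃ F : Set E, ∀ v, {d : E × Bool | a d = v ∧ d.1 ∈ F}.ncard = f v := by
  classical
  obtain ⟨M, hM⟩ := (halfEdgeGraph a f k).exists_isPerfectMatching_of_weight
    (halfEdgeWeight a f k) (r := 2 * k) (by omega) (fun _ _ h => h)
    (fun y => (sum_halfEdgeWeight (by omega) hf hdeg y).le)
    (fun C hC => by
      rw [sum_edgeCost]
      exact le_sum_edgeCost hk hk2 hf hdeg hodd C hC)
  rw [SimpleGraph.Subgraph.isPerfectMatching_iff] at hM
  have hflip : ∀ (e : E) (b : Bool), M.Adj (.inr (e, b)) (.inr (e, !b)) →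
      M.Adj (.inr (e, true)) (.inr (e, false)) := by
    rintro e (_ | _) h
    · exact h.symm
    · exact h
  -- Both half-edges of such an edge are matched to copies of their ends, so those at `v` correspond
  -- to the `f v` copies of `v`.
  refine ⟨{e | ¬ M.Adj (.inr (e, true)) (.inr (e, false))}, fun v => ?_⟩
  have hpartner : ∀ i : Fin (f v), ∃ d : E × Bool, a d = v ∧ M.Adj (.inl ⟨v, i⟩) (.inr d) := by
    intro i
    obtain ⟨y, hy, -⟩ := hM (.inl ⟨v, i⟩)
    have hw : halfEdgeWeight a f k _ _ ≠ 0 := hy.adj_sub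
    rcases y with y | d
    · simp [halfEdgeWeight] at hw
    · refine ⟨d, ?_, hy⟩
      by_contra hd
      simp [halfEdgeWeight, hd] at hw
  choose g hga hgM using hpartner
  have hinj : Function.Injective g := by
    intro i j hij
    have h := (hM (.inr (g i))).unique (hgM i).symm (by rw [hij]; exact (hgM j).symm)
    simpa using h
  have hrange : {d : E × Bool | a d = v ∧ d.1 ∈ {e | ¬ M.Adj (.inr (e, true)) (.inr (e, false))}} =
      Set.range g := by
    ext d
    constructor
    · rintro ⟨hd, hdF⟩
      obtain ⟨y, hy, -⟩ := hM (.inr d)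
      have hw : halfEdgeWeight a f k _ _ ≠ 0 := hy.adj_sub
      rcases y with ⟨v', i⟩ | d'
      · have : a d = v' := by
          by_contra h
          simp [halfEdgeWeight, h] at hw
        obtain rfl : v = v' := hd.symm.trans this
        refine ⟨i, ?_⟩
        have h := (hM (.inl ⟨v, i⟩)).unique (hgM i) hy.symm
        simpa using h
      · have : d' = (d.1, !d.2) := by
          by_contra h
          simp [halfEdgeWeight, h] at hw
        subst this
        exact absurd (hflip d.1 d.2 hy) hdF
    · rintro ⟨i, rfl⟩
      refine ⟨hga i, fun h => ?_⟩
      have h1 : ∃ d', M.Adj (.inr (g i)) (.inr d') := by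
        rcases hgi : g i with ⟨e, b⟩
        rw [hgi] at h
        cases b
        · exact ⟨_, h.symm⟩
        · exact ⟨_, h⟩
      obtain ⟨d', hd'⟩ := h1
      have h2 := (hM (.inr (g i))).unique (hgM i).symm hd'
      simp at h2
  rw [hrange, ← Set.image_univ, Set.ncard_image_of_injective _ hinj]
  simp [Set.ncard_univ]

end HalfEdges

/-! ### From multigraphs to half-edges -/

namespace Graph

variable {α β : Type*} {G : Graph α β}

/-- Let `T b` be the edges of `F` whose half-edge `b` is at `v`. Incident edges form the union of
the two sets and loops their intersection, so the degree is the sum of their sizes. -/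
theorem degree_restrict_image {a : G.edgeSet × Bool → G.vertexSet}
    (hE : G.edgeSet.Finite) (ha : ∀ e, G.IsLink e.1 (a (e, true)).1 (a (e, false)).1)
    (F : Set G.edgeSet) (v : G.vertexSet) :
    (G.restrict (Subtype.val '' F)).degree v = {d : G.edgeSet × Bool | a d = v ∧ d.1 ∈ F}.ncard := by
  have : Finite G.edgeSet := hE
  let T : Bool → Set G.edgeSet := fun b => {e | a (e, b) = v ∧ e ∈ F}
  have hinc : (G.restrict (Subtype.val '' F)).incidenceSet v =
      Subtype.val '' (T true ∪ T false) := by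
    ext e
    simp only [mem_incidenceSet, restrict_inc, Set.mem_image]
    constructor
    · rintro ⟨h, e, heF, rfl⟩
      refine ⟨e, ?_, rfl⟩
      rcases h.eq_or_eq_of_isLink (ha e) with h | h
      · exact Or.inl ⟨Subtype.ext h.symm, heF⟩
      · exact Or.inr ⟨Subtype.ext h.symm, heF⟩
    · rintro ⟨e, h | h, rfl⟩
      · exact ⟨h.1 ▸ (ha e).inc_left, e, h.2, rfl⟩
      · exact ⟨h.1 ▸ (ha e).inc_right, e, h.2, rfl⟩
  have hloop : (G.restrict (Subtype.val '' F)).loopSet v =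
      Subtype.val '' (T true ∩ T false) := by
    ext e
    simp only [mem_loopSet, restrict_isLoopAt, Set.mem_image]
    constructor
    · rintro ⟨h, e, heF, rfl⟩
      exact ⟨e, ⟨⟨Subtype.ext (h.eq_of_inc (ha e).inc_left).symm, heF⟩,
        ⟨Subtype.ext (h.eq_of_inc (ha e).inc_right).symm, heF⟩⟩, rfl⟩
    · rintro ⟨e, ⟨h, h'⟩, rfl⟩
      have hl := ha e
      rw [h.1, h'.1] at hl
      exact ⟨hl, e, h.2, rfl⟩
  have hdart : {d : G.edgeSet × Bool | a d = v ∧ d.1 ∈ F} =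
      (fun e => (e, true)) '' T true ∪ (fun e => (e, false)) '' T false := by
    ext ⟨e, b⟩
    cases b <;> simp [T]
  have hdisj : Disjoint ((fun e => (e, true)) '' T true) ((fun e => (e, false)) '' T false) := by
    rw [Set.disjoint_left]
    rintro _ ⟨e, -, rfl⟩ ⟨e', -, h⟩
    simp at h
  rw [degree, hinc, hloop, Set.ncard_image_of_injective _ Subtype.val_injective,
    Set.ncard_image_of_injective _ Subtype.val_injective, Set.ncard_union_add_ncard_inter,
    hdart, Set.ncard_union_eq hdisj, Set.ncard_image_of_injective _ (Prod.mk_left_injective _),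
    Set.ncard_image_of_injective _ (Prod.mk_left_injective _)]

theorem edgeCut_image {a : G.edgeSet × Bool → G.vertexSet}
    (ha : ∀ e, G.IsLink e.1 (a (e, true)).1 (a (e, false)).1) (X : Set G.vertexSet) :
    G.edgeCut (Subtype.val '' X) =
      Subtype.val '' {e : G.edgeSet | ¬ (a (e, true) ∈ X ↔ a (e, false) ∈ X)} := by
  have hX : ∀ v : G.vertexSet, v.1 ∈ Subtype.val '' X ↔ v ∈ X := fun v =>
    Subtype.val_injective.mem_set_image
  ext e
  constructor
  · rintro ⟨x, hx, y, hy, h⟩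
    refine ⟨⟨e, h.edge_mem⟩, ?_, rfl⟩
    rw [Set.mem_ofPred_eq, ← hX, ← hX]
    rcases h.eq_and_eq_or_eq_and_eq (ha ⟨e, h.edge_mem⟩) with ⟨h1, h2⟩ | ⟨h1, h2⟩
    · rw [← h1, ← h2]
      tauto
    · rw [← h1, ← h2]
      tauto
  · rintro ⟨e, he, rfl⟩
    rw [Set.mem_ofPred_eq, ← hX, ← hX] at he
    by_cases h : (a (e, true)).1 ∈ Subtype.val '' X
    · exact ⟨_, h, _, fun h' => he (by tauto), ha e⟩
    · exact ⟨_, by tauto, _, h, (ha e).symm⟩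

theorem OddEdgeConnected.le_ncard {k : ℕ} (hG : G.OddEdgeConnected k) (hk : Odd k) {X : Set α}
    (hX : X ⊆ G.vertexSet) (hodd : Odd (G.edgeCut X).ncard) : k ≤ (G.edgeCut X).ncard := by
  by_contra! hlt
  refine hG _ _ ?_ ⟨⟨X, hX, rfl⟩, rfl, hodd⟩
  -- Both sizes are odd, so being below `k` means being at most `k - 2`.
  obtain ⟨s, hs⟩ := hk
  obtain ⟨t, ht⟩ := hodd
  omega

theorem OddEdgeConnected.exists_isFactor {k : ℕ} (hG : G.OddEdgeConnected k) (hk : Odd k)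
    (hV : G.vertexSet.Finite) (hE : G.edgeSet.Finite) {f : α → ℕ}
    (hf : ∀ v ∈ G.vertexSet, f v = 1 ∨ f v = 2) (hdeg : ∀ v ∈ G.vertexSet, G.degree v = k * f v) :
    ∃ H : Graph α β, G.IsFactor f H := by
  classical
  -- For `k = 1` the degrees already equal `f`, so `G` is its own factor; for `k ≥ 2` the term `2 *
  -- k - 4` in the cut estimate is not truncated.
  rcases Nat.lt_or_ge k 2 with hk1 | hk2
  · have : k = 1 := by
      obtain ⟨s, hs⟩ := hk
      omega
    subst this
    exact ⟨G, ⟨le_refl G, rfl⟩, fun v hv => by rw [hdeg v hv, one_mul]⟩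
  have := hV.fintype
  have := hE.fintype
  have hends : ∀ e : G.edgeSet, ∃ p : G.vertexSet × G.vertexSet, G.IsLink e.1 p.1.1 p.2.1 := by
    intro e
    obtain ⟨x, y, h⟩ := G.exists_isLink_of_mem_edgeSet e.2
    exact ⟨(⟨x, h.left_mem⟩, ⟨y, h.right_mem⟩), h⟩
  choose p hp using hends
  let a : G.edgeSet × Bool → G.vertexSet := fun d => if d.2 then (p d.1).1 else (p d.1).2
  have ha : ∀ e, G.IsLink e.1 (a (e, true)).1 (a (e, false)).1 := fun e => by simpa [a] using hp e
  obtain ⟨F, hF⟩ := exists_halfEdge_factor (a := a) (f := fun v => f v.1) hk hk2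
    (fun v => hf v.1 v.2) (fun v => by
      have h := degree_restrict_image hE ha Set.univ v
      rw [Set.image_univ, Subtype.range_coe, restrict_self, hdeg v.1 v.2] at h
      rw [h, ← Set.ncard_coe_finset]
      simp) (fun X => by
      have h := edgeCut_image ha (X : Set G.vertexSet)
      have h2 := hG.le_ncard hk (X := Subtype.val '' (X : Set G.vertexSet)) (by
        rintro _ ⟨v, -, rfl⟩
        exact v.2)
      rw [h, Set.ncard_image_of_injective _ Subtype.val_injective] at h2
      rw [← Set.ncard_coe_finset]
      simpa using h2)
  refine ⟨G.restrict (Subtype.val '' F), ⟨restrict_le, rfl⟩, fun v hv => ?_⟩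
  rw [degree_restrict_image hE ha F ⟨v, hv⟩, hF]

end Graph

theorem mainTheorem6 {α β : Type*} (G : Graph α β)
    (hV : G.vertexSet.Finite) (hE : G.edgeSet.Finite)
    (k : ℕ) (hk : Odd k) (hG : G.OddEdgeConnected k)
    (hdeg : ∀ v ∈ G.vertexSet, G.degree v = k ∨ G.degree v = 2 * k)
    (f : α → ℕ) (hf : ∀ v ∈ G.vertexSet, (f v : ℚ) = (G.degree v : ℚ) / (k : ℚ)) :
    (∀ v ∈ G.vertexSet, f v = 1 ∨ f v = 2) ∧ ∃ H : Graph α β, G.IsFactor f H := by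
  have hk0 : (k : ℚ) ≠ 0 := Nat.cast_ne_zero.2 hk.pos.ne'
  have hdeg' : ∀ v ∈ G.vertexSet, G.degree v = k * f v := by
    intro v hv
    have h := hf v hv
    rw [eq_div_iff hk0] at h
    rw [mul_comm]
    exact_mod_cast h.symm
  have hf12 : ∀ v ∈ G.vertexSet, f v = 1 ∨ f v = 2 := by
    intro v hv
    have h := hdeg' v hv
    rcases hdeg v hv with h1 | h2
    · exact Or.inl (Nat.eq_of_mul_eq_mul_left hk.pos (by omega))
    · exact Or.inr (Nat.eq_of_mul_eq_mul_left hk.pos (by omega))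
  exact ⟨hf12, hG.exists_isFactor hk hV hE hf12 hdeg'⟩
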